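/- For positive integers $m\le n$, an $(n,m)$-permutation is an ordered selection without replacement $\nu=(\nu(1),\dots,\nu(m))$ of $m$ distinct elements of $[n]=\{1,\dots,n\}$. Its corresponding measure $\mu_\nu$ is the probability measure on $\mathbb{R}^2$ with density $f_\nu(x,y)=\frac{n^2}{m}$ if $(x,y)\in\left[\frac{h-1}{n},\frac{h}{n}\right)\times\left[\frac{\nu(h)-1}{n},\frac{\nu(h)}{n}\right)$ for some $h\in\{1,\dots,m\}$, and $f_\nu(x,y)=0$ otherwise. The marginal distribution functions of $\nu$ are the marginal distribution functions $F_x,F_y$ of $\mu_\nu$. For a permutation $\tau$ of $[k]$ with $k\le m$, let $t(\tau,\nu)=\Gamma(\tau,\nu)/\binom{m}{k}$, where $\Gamma(\tau,\nu)$ is the number of vectors $x_1<\dots<x_k$ in $[m]$ such that, for all $i,j$, $\nu(x_i)<\nu(x_j)$ if and only if $\tau(i)<\tau(j)$. For $\lambda\in(0,1]$, a $\lambda$-permuton is a probability measure $\mu$ concentrated on $[0,\lambda]\times[0,1]$ whose first marginal distribution function satisfies $F_x(x)=x/\lambda$ for $x\in[0,\lambda]$ and whose second marginal distribution function $F_y$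 is continuous and satisfies $F_y(b)-F_y(a)\le (b-a)/\lambda$ for $0\le a<b\le 1$. A generalized permuton is a $\lambda$-permuton for some $\lambda\in(0,1]$; each $\mu_\nu$ is one (with $\lambda=m/n$). For a generalized permuton $\mu$ and a permutation $\tau$ of $[k]$, $t(\tau,\mu)$ is the probability that, in an i.i.d. sample of $k$ points from $\mu$, for every $i\in[k]$ the point with the $i$-th smallest first coordinate has the $\tau(i)$-th smallest second coordinate. For generalized permutons $\mu_n$ and $\mu$, write $\mu_n\xrightarrow{t}\mu$ if $t(\tau,\mu_n)\to t(\tau,\mu)$ for every permutation $\tau$ of every order $k\ge1$ and the marginal distribution functions of $\mu_n$ converge weakly to the corresponding ones of $\mu$ (that is, pointwise at every continuity point of the limit). **Theorem.** Let $(m_n)_{n\ge1}$ be positive integers with $m_n\le n$ and $m_n/n\to\lambda\in(0,1]$, and let $\nu_n$ be an $(n,m_n)$-permutation for each $n\ge 1$. Suppose that $(\nu_n)$ is convergent: for every permutation $\tau$ of every order $k\ge 1$ the sequence $t(\tau,\nu_n)$ (defined as soon as $m_n\ge k$) converges, and the marginal distribution functions of $\nu_n$ converge pointwise as $n\to\infty$.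 Let $\mu_n=\mu_{\nu_n}$. Then there exists a generalized permuton $\mu$ such that $\mu_n\xrightarrow{t}\mu$. -/

import Mathlib

open MeasureTheory Filter Topology

/-- An `(n,m)`-permutation: an ordered selection without replacement of `m` elements out of `n`
elements, `ν = (ν(1), …, ν(m))`. Positions and values are counted from `0`, and `m ≤ n` is
automatic. -/
abbrev OrderedSelection (n m : ℕ) : Type := Fin m ↪ Fin n

namespace OrderedSelection

/-- The half-open square of side `1/n` in column `h` and row `ν h` (counted from `0`). -/
def cell {n m : ℕ} (ν : OrderedSelection n m) (h : Fin m) : Set (ℝ × ℝ) :=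
  Set.Ico ((h : ℝ) / n) (((h : ℝ) + 1) / n) ×ˢ
    Set.Ico (((ν h : ℕ) : ℝ) / n) ((((ν h : ℕ) : ℝ) + 1) / n)

/-- The density `f_ν`, equal to `n² / m` on the selected squares and to `0` elsewhere. -/
noncomputable def density {n m : ℕ} (ν : OrderedSelection n m) : ℝ × ℝ → ℝ :=
  (⋃ h : Fin m, ν.cell h).indicator fun _ => (n : ℝ) ^ 2 / m

/-- The generalized permuton `μ_ν` corresponding to `ν`: the measure on the plane with
Lebesgue density `f_ν`. -/
noncomputable def permuton {n m : ℕ} (ν : OrderedSelection n m) : Measure (ℝ × ℝ) :=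
  volume.withDensity fun p => ENNReal.ofReal (ν.density p)

/-- The number of increasing position vectors `x₁ < … < x_k` at which `ν` has the
relative order of `τ`. -/
noncomputable def patternCount {n m k : ℕ} (τ : Equiv.Perm (Fin k))
    (ν : OrderedSelection n m) : ℕ :=
  Nat.card {x : Fin k → Fin m // StrictMono x ∧ ∀ i j, ν (x i) < ν (x j) ↔ τ i < τ j}

/-- The density `t(τ, ν)` of the permutation `τ` of order `k` in `ν` (meaningful for `k ≤ m`). -/
noncomputable def permDensity {n m k : ℕ} (τ : Equiv.Perm (Fin k))
    (ν : OrderedSelection n m) : ℝ :=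
  (patternCount τ ν : ℝ) / (m.choose k : ℝ)

end OrderedSelection

/-- The first marginal distribution function of a probability measure on the plane. -/
noncomputable def marginalX (μ : Measure (ℝ × ℝ)) (x : ℝ) : ℝ := ProbabilityTheory.cdf μ.fst x

/-- The second marginal distribution function of a probability measure on the plane. -/
noncomputable def marginalY (μ : Measure (ℝ × ℝ)) (y : ℝ) : ℝ := ProbabilityTheory.cdf μ.snd y

/-- `μ` is a `lam`-permuton. -/
structure IsLambdaPermuton (lam : ℝ) (μ : Measure (ℝ × ℝ)) : Prop where
  lam_mem : lam ∈ Set.Ioc (0 : ℝ) 1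
  isProbabilityMeasure : IsProbabilityMeasure μ
  concentrated : μ (Set.Icc 0 lam ×ˢ Set.Icc 0 1)ᶜ = 0
  marginalX_eq : ∀ x ∈ Set.Icc 0 lam, marginalX μ x = x / lam
  marginalY_continuous : Continuous (marginalY μ)
  marginalY_slope : ∀ a b : ℝ, 0 ≤ a → a < b → b ≤ 1 →
    marginalY μ b - marginalY μ a ≤ (b - a) / lam

/-- `μ` is a generalized permuton: a `lam`-permuton for some `lam ∈ (0, 1]`. -/
def IsGeneralizedPermuton (μ : Measure (ℝ × ℝ)) : Prop := ∃ lam : ℝ, IsLambdaPermuton lam μ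

/-- The permutation `σ` of a sample `(ξ₁, η₁), …, (ξ_k, η_k)`: the point with the `i`-th smallest
first coordinate has the `σ i`-th smallest second coordinate. Here `Tuple.sort ξ i` is the index
of the `i`-th smallest entry of `ξ`; ties (of probability zero for the measures of interest)
are broken by the index. -/
noncomputable def samplePerm {k : ℕ} (ω : Fin k → ℝ × ℝ) : Equiv.Perm (Fin k) :=
  (Tuple.sort fun i => (ω i).2)⁻¹ * Tuple.sort fun i => (ω i).1

/-- The density `t(τ, μ)` of the permutation `τ` of order `k` in `μ`: the probability that the
permutation of an i.i.d. sample of size `k` from `μ` is `τ`. -/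
noncomputable def permDensity {k : ℕ} (τ : Equiv.Perm (Fin k)) (μ : Measure (ℝ × ℝ)) : ℝ :=
  (Measure.pi fun _ : Fin k => μ).real {ω | samplePerm ω = τ}

/-- Weak convergence `F_n ⇒ F` of distribution functions: pointwise convergence at every
continuity point of the limit. -/
def CdfTendsto (F : ℕ → ℝ → ℝ) (G : ℝ → ℝ) : Prop :=
  ∀ x, ContinuousAt G x → Tendsto (fun n => F n x) atTop (𝓝 (G x))

/-- Convergence `μ_n → μ` in the sense of permutation densities (together with the marginals). -/
structure TendstoPermDensities (μs : ℕ → Measure (ℝ × ℝ)) (μ : Measure (ℝ × ℝ)) : Prop where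
  permDensity : ∀ (k : ℕ) (τ : Equiv.Perm (Fin k)),
    Tendsto (fun n => permDensity τ (μs n)) atTop (𝓝 (permDensity τ μ))
  marginalX : CdfTendsto (fun n => marginalX (μs n)) (marginalX μ)
  marginalY : CdfTendsto (fun n => marginalY (μs n)) (marginalY μ)

/-- Convergence of a sequence of `(n, m_n)`-permutations `ν_n`: every permutation density
converges, and so do the marginal distribution functions (which are those of `μ_{ν_n}`)
at every point. -/
structure IsConvergentSelection {m : ℕ → ℕ} (ν : ∀ n, OrderedSelection n (m n)) : Prop where
  permDensity : ∀ (k : ℕ) (τ : Equiv.Perm (Fin k)),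
    ∃ t : ℝ, Tendsto (fun n => OrderedSelection.permDensity τ (ν n)) atTop (𝓝 t)
  marginalX : ∀ x : ℝ, ∃ c : ℝ, Tendsto (fun n => marginalX (ν n).permuton x) atTop (𝓝 c)
  marginalY : ∀ y : ℝ, ∃ c : ℝ, Tendsto (fun n => marginalY (ν n).permuton y) atTop (𝓝 c)

/-! ### The permutation of a sample -/

/-! The measures of the selections live on the compact unit square, so by Prokhorov they have a weak
limit `μ` along an ultrafilter finer than `atTop` (`exists_tendsto_permuton`). No subsequence is
needed: every quantity in question already converges along `atTop`, so it suffices to identify its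
limit along the ultrafilter.

The identification rests on one uniform bound: both marginals of the measure of an `(n,m)`-selection
have density at most `n / m` (`fst_permuton_le`, `snd_permuton_le`). In the limit the marginals of
`μ` have density at most `1 / lam`. This makes `μ` a `lam`-permuton
(`isLambdaPermuton_of_measure_Ioo_le`) and leaves its marginals without atoms. Hence ties in a
sample from `μ` are null, and pattern densities and marginal distribution functions are weakly
continuous at `μ` (`tendsto_permDensity_of_tendsto`, `tendsto_cdf_of_tendsto`).

Finally, sampling from the measure of a selection amounts to choosing `k` uniform positions with
replacement. Repetitions become negligible as the length grows, so the densities of the selections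
and of their measures have the same limit (`abs_permDensity_permuton_sub_le`). -/

theorem Tuple.sort_eq_of_strictMono {k : ℕ} {α : Type*} [LinearOrder α] {f : Fin k → α}
    {σ : Equiv.Perm (Fin k)} (h : StrictMono (f ∘ σ)) : Tuple.sort f = σ := by
  symm
  rw [Tuple.eq_sort_iff]
  exact ⟨h.monotone, fun i j hij he => absurd he (h hij).ne⟩

theorem Tuple.strictMono_comp_sort {k : ℕ} {α : Type*} [LinearOrder α] {f : Fin k → α}
    (hf : Function.Injective f) : StrictMono (f ∘ Tuple.sort f) :=
  (Tuple.monotone_sort f).strictMono_of_injective (hf.comp (Tuple.sort f).injective)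

theorem Tuple.sort_eq_sort_of_lt_imp_lt {k : ℕ} {α β : Type*} [LinearOrder α] [LinearOrder β]
    {f : Fin k → α} {g : Fin k → β} (hf : Function.Injective f)
    (h : ∀ i j, f i < f j → g i < g j) : Tuple.sort g = Tuple.sort f :=
  Tuple.sort_eq_of_strictMono fun _ _ hij => h _ _ (Tuple.strictMono_comp_sort hf hij)

/-- Two samples whose coordinates are ordered in the same way have the same permutation. -/
theorem samplePerm_eq_of_lt_imp_lt {k : ℕ} {ω ω' : Fin k → ℝ × ℝ}
    (h₁ : Function.Injective fun i => (ω i).1) (h₂ : Function.Injective fun i => (ω i).2)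
    (h₁' : ∀ i j, (ω i).1 < (ω j).1 → (ω' i).1 < (ω' j).1)
    (h₂' : ∀ i j, (ω i).2 < (ω j).2 → (ω' i).2 < (ω' j).2) :
    samplePerm ω' = samplePerm ω := by
  unfold samplePerm
  rw [Tuple.sort_eq_sort_of_lt_imp_lt h₁ h₁', Tuple.sort_eq_sort_of_lt_imp_lt h₂ h₂']

theorem eventually_samplePerm_eq {k : ℕ} {ω : Fin k → ℝ × ℝ}
    (h₁ : Function.Injective fun i => (ω i).1) (h₂ : Function.Injective fun i => (ω i).2) :
    ∀ᶠ ω' in 𝓝 ω, samplePerm ω' = samplePerm ω := by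
  have key : ∀ f : ℝ × ℝ → ℝ, Continuous f →
      ∀ᶠ ω' in 𝓝 ω, ∀ i j, f (ω i) < f (ω j) → f (ω' i) < f (ω' j) := by
    intro f hf
    simp only [eventually_all]
    intro i j hij
    exact ContinuousAt.eventually_lt (hf.comp (continuous_apply i)).continuousAt
      (hf.comp (continuous_apply j)).continuousAt hij
  filter_upwards [key _ continuous_fst, key _ continuous_snd] with ω' h h'
  exact samplePerm_eq_of_lt_imp_lt h₁ h₂ h h'

/-- Where all coordinates are distinct, the strict inequalities between them persist nearby, so the
sample permutation is locally constant there; only ties can lie on the frontier. -/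
theorem frontier_samplePerm_subset {k : ℕ} (τ : Equiv.Perm (Fin k)) :
    frontier {ω : Fin k → ℝ × ℝ | samplePerm ω = τ} ⊆
      {ω | ¬ Function.Injective fun i => (ω i).1} ∪
        {ω | ¬ Function.Injective fun i => (ω i).2} := by
  intro ω hω
  by_contra hc
  simp only [Set.mem_union, Set.mem_ofPred_eq, not_or, not_not] at hc
  have hev := eventually_samplePerm_eq hc.1 hc.2
  by_cases hτ : samplePerm ω = τ
  · refine hω.2 (mem_interior_iff_mem_nhds.2 ?_)
    filter_upwards [hev] with ω' h using h.trans hτ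
  · obtain ⟨ω', h, h'⟩ := ((mem_closure_iff_frequently.1 hω.1).and_eventually hev).exists
    exact hτ (h'.symm.trans h)

/-- In an i.i.d. sample, a function with an atomless distribution takes distinct values. -/
theorem measure_pi_not_injective_comp {k : ℕ} {α : Type*} [MeasurableSpace α] (μ : Measure α)
    [IsProbabilityMeasure μ] {f : α → ℝ} (hf : Measurable f)
    (ha : NullSingletonClass (μ.map f)) :
    (Measure.pi fun _ : Fin k => μ) {ω | ¬ Function.Injective fun i => f (ω i)} = 0 := by
  have : IsProbabilityMeasure (μ.map f) := Measure.isProbabilityMeasure_map hf.aemeasurable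
  have hsub : {ω : Fin k → α | ¬ Function.Injective fun i => f (ω i)} ⊆
      ⋃ i, ⋃ j, ⋃ _ : i ≠ j, {ω | f (ω i) = f (ω j)} := by
    intro ω hω
    simp only [Set.mem_ofPred_eq, Function.Injective, not_forall] at hω
    obtain ⟨i, j, h, hij⟩ := hω
    simp only [Set.mem_iUnion]
    exact ⟨i, j, hij, h⟩
  refine measure_mono_null hsub ?_
  simp only [measure_iUnion_null_iff]
  intro i j hij
  have hind : ProbabilityTheory.IndepFun (fun ω : Fin k → α => f (ω i)) (fun ω => f (ω j))
      (Measure.pi fun _ : Fin k => μ) :=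
    (ProbabilityTheory.iIndepFun_pi (μ := fun _ : Fin k => μ) (X := fun _ => f)
      fun _ => hf.aemeasurable).indepFun hij
  have hmap : ∀ i, (Measure.pi fun _ : Fin k => μ).map (fun ω => f (ω i)) = μ.map f := by
    intro i
    have h := Measure.map_map hf (measurable_pi_apply i) (μ := Measure.pi fun _ : Fin k => μ)
    rw [(measurePreserving_eval (fun _ : Fin k => μ) i).map_eq] at h
    exact h.symm
  have hm : ∀ i, Measurable fun ω : Fin k → α => f (ω i) :=
    fun i => hf.comp (measurable_pi_apply i)
  have hprod := hind.map_prod_eq_prod_map_map (hm i).aemeasurable (hm j).aemeasurable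
  rw [hmap, hmap] at hprod
  have hdiag : MeasurableSet {p : ℝ × ℝ | p.1 = p.2} :=
    measurableSet_eq_fun measurable_fst measurable_snd
  have hnull : ((μ.map f).prod (μ.map f)) {p : ℝ × ℝ | p.1 = p.2} = 0 := by
    rw [Measure.measure_prod_null hdiag]
    refine Eventually.of_forall fun x => ?_
    have : Prod.mk x ⁻¹' {p : ℝ × ℝ | p.1 = p.2} = {x} := by
      ext y; simp [eq_comm]
    simp [this]
  rw [← hprod, Measure.map_apply ((hm i).prodMk (hm j)) hdiag] at hnull
  exact hnull

/-- Pattern densities are continuous, for weak convergence, at a measure with atomless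
marginals. -/
theorem tendsto_permDensity_of_tendsto {ι : Type*} {L : Filter ι} {k : ℕ}
    (τ : Equiv.Perm (Fin k)) {P : ι → ProbabilityMeasure (ℝ × ℝ)} {μ : ProbabilityMeasure (ℝ × ℝ)}
    (h₁ : NullSingletonClass (μ : Measure (ℝ × ℝ)).fst)
    (h₂ : NullSingletonClass (μ : Measure (ℝ × ℝ)).snd)
    (h : Tendsto P L (𝓝 μ)) :
    Tendsto (fun i => permDensity τ (P i : Measure (ℝ × ℝ))) L
      (𝓝 (permDensity τ (μ : Measure (ℝ × ℝ)))) := by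
  -- Finite products are weakly continuous, so the portmanteau theorem for `k`-fold samples applies
  -- once the event has null frontier.
  have hpi : Tendsto (fun i => ProbabilityMeasure.pi fun _ : Fin k => P i) L
      (𝓝 (ProbabilityMeasure.pi fun _ : Fin k => μ)) :=
    ((ProbabilityMeasure.continuous_pi (α := fun _ : Fin k => ℝ × ℝ)).tendsto _).comp
      (tendsto_pi_nhds.2 fun _ => h)
  have hfr : (Measure.pi fun _ : Fin k => (μ : Measure (ℝ × ℝ)))
      (frontier {ω | samplePerm ω = τ}) = 0 :=
    measure_mono_null (frontier_samplePerm_subset τ) (measure_union_null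
      (measure_pi_not_injective_comp _ measurable_fst h₁)
      (measure_pi_not_injective_comp _ measurable_snd h₂))
  exact (ENNReal.tendsto_toReal (measure_ne_top _ _)).comp
    (ProbabilityMeasure.tendsto_measure_of_null_frontier_of_tendsto' hpi hfr)

/-! ### The measure of an ordered selection -/

theorem disjoint_Ico_div (n : ℕ) {a b : ℕ} (h : a ≠ b) :
    Disjoint (Set.Ico ((a : ℝ) / n) (((a : ℝ) + 1) / n))
      (Set.Ico ((b : ℝ) / n) (((b : ℝ) + 1) / n)) := by
  wlog hab : a < b generalizing a b
  · exact (this h.symm (lt_of_le_of_ne (not_lt.1 hab) h.symm)).symm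
  rw [Set.Ico_disjoint_Ico]
  have : (a : ℝ) + 1 ≤ b := by exact_mod_cast hab
  exact (min_le_left _ _).trans ((div_le_div_of_nonneg_right this n.cast_nonneg).trans
    (le_max_right _ _))

theorem sum_volume_inter_Ico_div_le (n : ℕ) {ι : Type*} [Fintype ι] {f : ι → ℕ}
    (hf : Function.Injective f) {A : Set ℝ} (hA : MeasurableSet A) :
    ∑ i, volume (A ∩ Set.Ico ((f i : ℝ) / n) (((f i : ℝ) + 1) / n)) ≤ volume A := by
  rw [← tsum_fintype (L := .unconditional ι), ← measure_iUnion]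
  · exact measure_mono (Set.iUnion_subset fun i => Set.inter_subset_left)
  · exact fun i j hij => (disjoint_Ico_div n (hf.ne hij)).mono Set.inter_subset_right
      Set.inter_subset_right
  · exact fun i => hA.inter measurableSet_Ico

theorem volume_Ico_div {n : ℕ} (a : ℕ) :
    volume (Set.Ico ((a : ℝ) / n) (((a : ℝ) + 1) / n)) = ENNReal.ofReal (1 / n) := by
  rw [Real.volume_Ico]
  congr 1
  ring

namespace OrderedSelection

variable {n m : ℕ} (ν : OrderedSelection n m)

theorem measurableSet_cell (h : Fin m) : MeasurableSet (ν.cell h) :=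
  measurableSet_Ico.prod measurableSet_Ico

theorem disjoint_cell {h h' : Fin m} (hne : h ≠ h') : Disjoint (ν.cell h) (ν.cell h') :=
  Set.disjoint_prod.2 (Or.inl (disjoint_Ico_div n (Fin.val_injective.ne hne)))

theorem permuton_eq_smul_restrict :
    ν.permuton = ENNReal.ofReal ((n : ℝ) ^ 2 / m) • volume.restrict (⋃ h, ν.cell h) := by
  have h : (fun p => ENNReal.ofReal (ν.density p)) =
      (⋃ h, ν.cell h).indicator fun _ => ENNReal.ofReal ((n : ℝ) ^ 2 / m) := by
    ext p
    by_cases hp : p ∈ ⋃ h, ν.cell h <;> simp only [density, Set.indicator, hp, if_true, if_false,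
      ENNReal.ofReal_zero]
  rw [permuton, h, withDensity_indicator (MeasurableSet.iUnion ν.measurableSet_cell),
    withDensity_const]

theorem permuton_apply {S : Set (ℝ × ℝ)} (hS : MeasurableSet S) :
    ν.permuton S = ENNReal.ofReal ((n : ℝ) ^ 2 / m) * ∑ h, volume (S ∩ ν.cell h) := by
  rw [permuton_eq_smul_restrict, Measure.smul_apply, Measure.restrict_apply hS, smul_eq_mul,
    Set.inter_iUnion, measure_iUnion, tsum_fintype]
  · exact fun i j hij => (ν.disjoint_cell hij).mono Set.inter_subset_right Set.inter_subset_right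
  · exact fun i => hS.inter (ν.measurableSet_cell i)

theorem pos_of_pos_length {n m : ℕ} (ν : OrderedSelection n m) (hm : 0 < m) : 0 < n := by
  have := (ν ⟨0, hm⟩).isLt
  omega

theorem permuton_cell (hm : 0 < m) (h : Fin m) : ν.permuton (ν.cell h) = (m : ENNReal)⁻¹ := by
  have hn : (0 : ℝ) < n := by exact_mod_cast ν.pos_of_pos_length hm
  have hm' : (0 : ℝ) < m := by exact_mod_cast hm
  rw [permuton_eq_smul_restrict, Measure.smul_apply, smul_eq_mul,
    Measure.restrict_eq_self _ (Set.subset_iUnion ν.cell h), cell, Measure.volume_eq_prod,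
    Measure.prod_prod, volume_Ico_div, volume_Ico_div, ← ENNReal.ofReal_mul (by positivity),
    ← ENNReal.ofReal_mul (by positivity), ← ENNReal.ofReal_natCast, ← ENNReal.ofReal_inv_of_pos hm']
  congr 1
  field_simp

theorem permuton_compl_iUnion_cell : ν.permuton (⋃ h, ν.cell h)ᶜ = 0 := by
  rw [permuton_eq_smul_restrict, Measure.smul_apply, smul_eq_mul,
    Measure.restrict_apply (MeasurableSet.iUnion ν.measurableSet_cell).compl, Set.compl_inter_self,
    measure_empty, mul_zero]

theorem isProbabilityMeasure_permuton (hm : 0 < m) : IsProbabilityMeasure ν.permuton := by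
  constructor
  have hmeas : MeasurableSet (⋃ h, ν.cell h) := MeasurableSet.iUnion ν.measurableSet_cell
  rw [← measure_add_measure_compl hmeas, permuton_compl_iUnion_cell, add_zero, measure_iUnion
    (fun i j hij => ν.disjoint_cell hij) ν.measurableSet_cell, tsum_fintype]
  simp only [ν.permuton_cell hm, Finset.sum_const, Finset.card_univ, Fintype.card_fin,
    nsmul_eq_mul]
  exact ENNReal.mul_inv_cancel (by exact_mod_cast hm.ne') (ENNReal.natCast_ne_top m)

theorem permuton_compl_rectangle :
    ν.permuton (Set.Icc 0 ((m : ℝ) / n) ×ˢ Set.Icc 0 1)ᶜ = 0 := by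
  refine measure_mono_null (Set.compl_subset_compl.2 (Set.iUnion_subset fun h => ?_))
    ν.permuton_compl_iUnion_cell
  refine Set.prod_mono ?_ ?_ <;> refine Set.Ico_subset_Icc_self.trans (Set.Icc_subset_Icc
    (by positivity) ?_)
  · exact div_le_div_of_nonneg_right (by exact_mod_cast h.isLt) n.cast_nonneg
  · exact div_le_one_of_le₀ (by exact_mod_cast (ν h).isLt) n.cast_nonneg

theorem fst_permuton_le (hm : 0 < m) {A : Set ℝ} (hA : MeasurableSet A) :
    ν.permuton.fst A ≤ ENNReal.ofReal ((n : ℝ) / m) * volume A := by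
  have hn : (0 : ℝ) < n := by exact_mod_cast ν.pos_of_pos_length hm
  have hcell : ∀ h, volume (Prod.fst ⁻¹' A ∩ ν.cell h) =
      ENNReal.ofReal (1 / n) * volume (A ∩ Set.Ico ((h : ℝ) / n) (((h : ℝ) + 1) / n)) := by
    intro h
    rw [cell, ← Set.prod_univ, Set.prod_inter_prod, Set.univ_inter, Measure.volume_eq_prod,
      Measure.prod_prod, volume_Ico_div, mul_comm]
  rw [Measure.fst_apply hA, ν.permuton_apply (measurable_fst hA)]
  simp only [hcell]
  rw [← Finset.mul_sum, ← mul_assoc, ← ENNReal.ofReal_mul (by positivity),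
    show (n : ℝ) ^ 2 / m * (1 / n) = n / m by field_simp]
  gcongr
  exact sum_volume_inter_Ico_div_le n Fin.val_injective hA

/-- Injectivity of `ν` puts the cells in disjoint rows, so no horizontal strip is charged twice. -/
theorem snd_permuton_le (hm : 0 < m) {A : Set ℝ} (hA : MeasurableSet A) :
    ν.permuton.snd A ≤ ENNReal.ofReal ((n : ℝ) / m) * volume A := by
  have hn : (0 : ℝ) < n := by exact_mod_cast ν.pos_of_pos_length hm
  have hcell : ∀ h, volume (Prod.snd ⁻¹' A ∩ ν.cell h) = ENNReal.ofReal (1 / n) *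
      volume (A ∩ Set.Ico (((ν h : ℕ) : ℝ) / n) ((((ν h : ℕ) : ℝ) + 1) / n)) := by
    intro h
    rw [cell, ← Set.univ_prod, Set.prod_inter_prod, Set.univ_inter, Measure.volume_eq_prod,
      Measure.prod_prod, volume_Ico_div]
  rw [Measure.snd_apply hA, ν.permuton_apply (measurable_snd hA)]
  simp only [hcell]
  rw [← Finset.mul_sum, ← mul_assoc, ← ENNReal.ofReal_mul (by positivity),
    show (n : ℝ) ^ 2 / m * (1 / n) = n / m by field_simp]
  gcongr
  exact sum_volume_inter_Ico_div_le n (f := fun h => (ν h : ℕ))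
    (Fin.val_injective.comp ν.injective) hA

end OrderedSelection

/-! ### Pattern counts as masses of products of cells -/

namespace OrderedSelection

variable {n m k : ℕ}

/-- The permutation induced by an ordered selection on a tuple of positions. -/
def tuplePerm (ν : OrderedSelection n m) (h : Fin k → Fin m) : Equiv.Perm (Fin k) :=
  (Tuple.sort (ν ∘ h))⁻¹ * Tuple.sort h

/-- Points in distinct columns, hence distinct rows, are ordered as the indices of those columns and
rows. -/
theorem samplePerm_eq_tuplePerm (ν : OrderedSelection n m) {h : Fin k → Fin m}
    (hh : Function.Injective h) {ω : Fin k → ℝ × ℝ} (hω : ∀ i, ω i ∈ ν.cell (h i)) :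
    samplePerm ω = ν.tuplePerm h := by
  have key : ∀ {a b : ℕ} {x y : ℝ}, a < b → x ∈ Set.Ico ((a : ℝ) / n) (((a : ℝ) + 1) / n) →
      y ∈ Set.Ico ((b : ℝ) / n) (((b : ℝ) + 1) / n) → x < y := by
    intro a b x y hab hx hy
    have h1 : (a : ℝ) + 1 ≤ b := by exact_mod_cast hab
    exact hx.2.trans_le ((div_le_div_of_nonneg_right h1 n.cast_nonneg).trans hy.1)
  unfold samplePerm tuplePerm
  rw [Tuple.sort_eq_sort_of_lt_imp_lt hh fun i j hij => key hij (hω i).1 (hω j).1,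
    Tuple.sort_eq_sort_of_lt_imp_lt (ν.injective.comp hh)
      fun i j hij => key (Fin.lt_def.1 hij) (hω i).2 (hω j).2]

/-- Relabelling a sample does not change its permutation, so `σ` plays no role on the right: the
positions are sorted by `σ`, and inducing `τ` means that the values are sorted by `σ * τ⁻¹`. -/
theorem tuplePerm_comp_symm (ν : OrderedSelection n m) {x : Fin k → Fin m} (hx : StrictMono x)
    (σ τ : Equiv.Perm (Fin k)) :
    ν.tuplePerm (x ∘ σ.symm) = τ ↔ ∀ i j, ν (x i) < ν (x j) ↔ τ i < τ j := by
  have hσ : Tuple.sort (x ∘ σ.symm) = σ :=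
    Tuple.sort_eq_of_strictMono (by simpa [Function.comp_assoc] using hx)
  have hinj : Function.Injective (ν ∘ x ∘ σ.symm) :=
    ν.injective.comp (hx.injective.comp σ.symm.injective)
  rw [tuplePerm, hσ]
  constructor
  · rintro h
    have hs : Tuple.sort (ν ∘ x ∘ σ.symm) = σ * τ⁻¹ := by rw [← h]; group
    have hmono := Tuple.strictMono_comp_sort hinj
    rw [hs] at hmono
    intro i j
    have := hmono.lt_iff_lt (a := τ i) (b := τ j)
    simpa using this
  · intro h
    have hs : Tuple.sort (ν ∘ x ∘ σ.symm) = σ * τ⁻¹ := by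
      refine Tuple.sort_eq_of_strictMono fun i j hij => ?_
      have := (h (τ.symm i) (τ.symm j)).2 (by simpa using hij)
      simpa using this
    rw [hs]
    group

/-- An injective tuple of positions is an increasing one together with a rearrangement. -/
noncomputable def tuplesWithPermEquiv (ν : OrderedSelection n m) (τ : Equiv.Perm (Fin k)) :
    {h : Fin k → Fin m // Function.Injective h ∧ ν.tuplePerm h = τ} ≃
      Equiv.Perm (Fin k) ×
        {x : Fin k → Fin m // StrictMono x ∧ ∀ i j, ν (x i) < ν (x j) ↔ τ i < τ j} where
  toFun h := ⟨Tuple.sort h.1, h.1 ∘ Tuple.sort h.1, Tuple.strictMono_comp_sort h.2.1, by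
    refine (ν.tuplePerm_comp_symm (Tuple.strictMono_comp_sort h.2.1) (Tuple.sort h.1) τ).1 ?_
    simpa [Function.comp_assoc] using h.2.2⟩
  invFun p := ⟨p.2.1 ∘ p.1.symm, p.2.2.1.injective.comp p.1.symm.injective,
    (ν.tuplePerm_comp_symm p.2.2.1 p.1 τ).2 p.2.2.2⟩
  left_inv h := by ext; simp
  right_inv p := by
    have hσ : Tuple.sort (p.2.1 ∘ p.1.symm) = p.1 :=
      Tuple.sort_eq_of_strictMono (by simpa [Function.comp_assoc] using p.2.2.1)
    refine Prod.ext hσ (Subtype.ext ?_)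
    simp [hσ, Function.comp_assoc]

open Classical in
/-- The injective tuples of positions inducing `τ`. -/
noncomputable def tuplesWithPerm (ν : OrderedSelection n m) (τ : Equiv.Perm (Fin k)) :
    Finset (Fin k → Fin m) :=
  Finset.univ.filter fun h => Function.Injective h ∧ ν.tuplePerm h = τ

open Classical in
theorem card_tuplesWithPerm (ν : OrderedSelection n m) (τ : Equiv.Perm (Fin k)) :
    (ν.tuplesWithPerm τ).card = k.factorial * patternCount τ ν := by
  rw [tuplesWithPerm, ← Fintype.card_subtype, ← Nat.card_eq_fintype_card,
    Nat.card_congr (ν.tuplesWithPermEquiv τ), Nat.card_prod, patternCount,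
    Nat.card_eq_fintype_card, Fintype.card_perm, Fintype.card_fin]

open Classical in
theorem card_injective_tuples :
    (Finset.univ.filter fun h : Fin k → Fin m => Function.Injective h).card =
      m.descFactorial k := by
  rw [← Fintype.card_subtype, Fintype.card_congr (Equiv.subtypeInjectiveEquivEmbedding _ _),
    Fintype.card_embedding_eq, Fintype.card_fin, Fintype.card_fin]

theorem measureReal_pi_biUnion_cell (ν : OrderedSelection n m) (hm : 0 < m)
    (S : Finset (Fin k → Fin m)) :
    (Measure.pi fun _ : Fin k => ν.permuton).real
      (⋃ h ∈ S, Set.univ.pi fun i => ν.cell (h i)) = S.card / (m : ℝ) ^ k := by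
  have := ν.isProbabilityMeasure_permuton hm
  rw [measureReal_biUnion_finset]
  · have : ∀ h : Fin k → Fin m, (Measure.pi fun _ : Fin k => ν.permuton).real
        (Set.univ.pi fun i => ν.cell (h i)) = ((m : ℝ) ^ k)⁻¹ := by
      intro h
      rw [measureReal_def, Measure.pi_pi]
      simp [ν.permuton_cell hm]
    simp [this, div_eq_mul_inv]
  · intro h _ h' _ hne
    obtain ⟨i, hi⟩ := Function.ne_iff.1 hne
    exact Set.disjoint_univ_pi.2 ⟨i, ν.disjoint_cell hi⟩
  · exact fun h _ => MeasurableSet.univ_pi fun i => ν.measurableSet_cell _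

open Classical in
/-- The pattern densities of an ordered selection and of its measure differ at most by the
probability that `k` independent uniform positions are not distinct. -/
theorem abs_permDensity_permuton_sub_le (ν : OrderedSelection n m) (hm : 0 < m) (hk : k ≤ m)
    (τ : Equiv.Perm (Fin k)) :
    |_root_.permDensity τ ν.permuton - permDensity τ ν| ≤
      1 - (m.descFactorial k : ℝ) / (m : ℝ) ^ k := by
  have := ν.isProbabilityMeasure_permuton hm
  set I : Finset (Fin k → Fin m) := Finset.univ.filter fun h => Function.Injective h
  have hGI : ν.tuplesWithPerm τ ⊆ I := fun h hh => by
    simp only [tuplesWithPerm, I, Finset.mem_filter] at hh ⊢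
    exact ⟨hh.1, hh.2.1⟩
  have hI : (I.card : ℝ) = m.descFactorial k := by exact_mod_cast card_injective_tuples
  have hG := ν.measureReal_pi_biUnion_cell hm (ν.tuplesWithPerm τ)
  have hIm := ν.measureReal_pi_biUnion_cell hm I
  set U : Finset (Fin k → Fin m) → Set (Fin k → ℝ × ℝ) := fun S =>
    ⋃ h ∈ S, Set.univ.pi fun i => ν.cell (h i) with hU
  have hlow : (Measure.pi fun _ : Fin k => ν.permuton).real (U (ν.tuplesWithPerm τ)) ≤
      _root_.permDensity τ ν.permuton := by
    refine measureReal_mono (Set.iUnion₂_subset fun h hh ω hω => ?_)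
    simp only [tuplesWithPerm, Finset.mem_filter] at hh
    exact (ν.samplePerm_eq_tuplePerm hh.2.1 fun i => hω i (Set.mem_univ i)).trans hh.2.2
  have hmeas : MeasurableSet (U I) := Finset.measurableSet_biUnion _ fun h _ =>
    MeasurableSet.univ_pi fun i => ν.measurableSet_cell _
  -- Off the cells of injective tuples nothing is known about the pattern, so their complement is
  -- counted in full; on those cells the pattern is that of the tuple.
  have hupp : _root_.permDensity τ ν.permuton ≤
      (Measure.pi fun _ : Fin k => ν.permuton).real (U (ν.tuplesWithPerm τ)) +
        (Measure.pi fun _ : Fin k => ν.permuton).real (U I)ᶜ := by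
    refine (measureReal_mono fun ω hω => ?_).trans (measureReal_union_le _ _)
    by_cases hωI : ω ∈ U I
    · left
      simp only [hU, Set.mem_iUnion] at hωI ⊢
      obtain ⟨h, hh, hωh⟩ := hωI
      have hinj : Function.Injective h := (Finset.mem_filter.1 hh).2
      refine ⟨h, ?_, hωh⟩
      simp only [tuplesWithPerm, Finset.mem_filter]
      exact ⟨Finset.mem_univ _, hinj,
        (ν.samplePerm_eq_tuplePerm hinj fun i => hωh i (Set.mem_univ i)).symm.trans hω⟩
    · exact Or.inr hωI
  rw [probReal_compl_eq_one_sub hmeas, hIm, hI, hG] at hupp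
  rw [hG] at hlow
  have hdesc : (0 : ℝ) < m.descFactorial k := by
    exact_mod_cast Nat.pos_of_ne_zero fun h => absurd (Nat.descFactorial_eq_zero_iff_lt.1 h)
      (not_lt.2 hk)
  have hpow : (0 : ℝ) < (m : ℝ) ^ k := by positivity
  have hd1 : (m.descFactorial k : ℝ) / (m : ℝ) ^ k ≤ 1 :=
    div_le_one_of_le₀ (by exact_mod_cast Nat.descFactorial_le_pow m k) hpow.le
  have hdens : permDensity τ ν = ((ν.tuplesWithPerm τ).card : ℝ) / m.descFactorial k := by
    have : (m.choose k : ℝ) * k.factorial = m.descFactorial k := by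
      rw [Nat.descFactorial_eq_factorial_mul_choose]
      push_cast
      ring
    have hk0 : (k.factorial : ℝ) ≠ 0 := by exact_mod_cast k.factorial_ne_zero
    rw [permDensity, card_tuplesWithPerm, ← this]
    push_cast
    rw [mul_comm (k.factorial : ℝ), mul_div_mul_right _ _ hk0]
  have hle : permDensity τ ν ≤ 1 := by
    rw [hdens, ← hI]
    exact div_le_one_of_le₀ (by exact_mod_cast Finset.card_le_card hGI) (by positivity)
  have h0 : 0 ≤ permDensity τ ν := by rw [hdens]; positivity
  have hfac : ((ν.tuplesWithPerm τ).card : ℝ) / (m : ℝ) ^ k =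
      permDensity τ ν * ((m.descFactorial k : ℝ) / (m : ℝ) ^ k) := by
    rw [hdens]
    field_simp
  rw [hfac] at hlow hupp
  rw [abs_le]
  -- With `d` the density in `ν`, `D` that in its measure and `q` the probability of distinct
  -- positions, the bounds read `d * q ≤ D ≤ d * q + (1 - q)`, and `0 ≤ d ≤ 1`.
  constructor <;> nlinarith

end OrderedSelection

theorem tendsto_permDensity_permuton_sub {m : ℕ → ℕ} (ν : ∀ n, OrderedSelection n (m n))
    (hm : Tendsto m atTop atTop) {k : ℕ} (τ : Equiv.Perm (Fin k)) :
    Tendsto (fun n => permDensity τ (ν n).permuton - OrderedSelection.permDensity τ (ν n))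
      atTop (𝓝 0) := by
  have hlim : Tendsto (fun j : ℕ => 1 - (j.descFactorial k : ℝ) / (j : ℝ) ^ k) atTop (𝓝 0) := by
    have h := (Asymptotics.isEquivalent_iff_tendsto_one ?_).1 (isEquivalent_descFactorial k)
    · simpa using h.const_sub 1
    · filter_upwards [eventually_gt_atTop 0] with j hj
      positivity
  refine squeeze_zero_norm' ?_ (hlim.comp hm)
  filter_upwards [hm.eventually_ge_atTop k, hm.eventually_gt_atTop 0] with n hk h0
  exact (ν n).abs_permDensity_permuton_sub_le h0 hk τ

/-! ### Weak limits of measures with bounded densities -/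

theorem tendsto_cdf_of_tendsto {ι : Type*} {L : Filter ι} {μ : ProbabilityMeasure ℝ}
    {P : ι → ProbabilityMeasure ℝ} (h : Tendsto P L (𝓝 μ))
    (hμ : NullSingletonClass (μ : Measure ℝ)) (x : ℝ) :
    Tendsto (fun i => ProbabilityTheory.cdf (P i : Measure ℝ) x) L
      (𝓝 (ProbabilityTheory.cdf (μ : Measure ℝ) x)) := by
  simp only [ProbabilityTheory.cdf_eq_real]
  exact (ENNReal.tendsto_toReal (measure_ne_top _ _)).comp
    (ProbabilityMeasure.tendsto_measure_of_null_frontier_of_tendsto' h (by simp))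

section Limits

variable {ι : Type*} {L : Filter ι} [L.NeBot] {μ : ProbabilityMeasure ℝ}
  {P : ι → ProbabilityMeasure ℝ} {c : ι → ℝ} {C : ℝ}

/-- Open sets are the ones whose limiting mass is at most the liminf of the masses, so upper bounds
pass to the limit on open intervals. -/
theorem measure_Ioo_le_of_tendsto (h : Tendsto P L (𝓝 μ)) (hc : Tendsto c L (𝓝 C))
    (hle : ∀ᶠ i in L, ∀ A, MeasurableSet A → (P i : Measure ℝ) A ≤ ENNReal.ofReal (c i) * volume A)
    (a b : ℝ) : (μ : Measure ℝ) (Set.Ioo a b) ≤ ENNReal.ofReal C * ENNReal.ofReal (b - a) := by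
  have hlim : Tendsto (fun i => ENNReal.ofReal (c i) * ENNReal.ofReal (b - a)) L
      (𝓝 (ENNReal.ofReal C * ENNReal.ofReal (b - a))) :=
    ENNReal.Tendsto.mul_const (ENNReal.tendsto_ofReal hc) (Or.inr ENNReal.ofReal_ne_top)
  rw [← hlim.liminf_eq]
  refine (ProbabilityMeasure.le_liminf_measure_open_of_tendsto h isOpen_Ioo).trans
    (liminf_le_liminf ?_)
  filter_upwards [hle] with i hi
  exact (hi _ measurableSet_Ioo).trans_eq (by rw [Real.volume_Ioo])

theorem nullSingletonClass_of_measure_Ioo_le {μ : Measure ℝ}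
    (h : ∀ a b, μ (Set.Ioo a b) ≤ ENNReal.ofReal C * ENNReal.ofReal (b - a)) :
    NullSingletonClass μ := by
  constructor
  intro x
  have hlim : Tendsto (fun ε : ℝ => ENNReal.ofReal C * ENNReal.ofReal (x + ε - (x - ε)))
      (𝓝[>] 0) (𝓝 0) := by
    have h0 : Tendsto (fun ε : ℝ => x + ε - (x - ε)) (𝓝[>] 0) (𝓝 0) := by
      have : Continuous fun ε : ℝ => x + ε - (x - ε) := by fun_prop
      simpa using (this.tendsto 0).mono_left nhdsWithin_le_nhds
    simpa using ENNReal.Tendsto.const_mul (a := ENNReal.ofReal C) (ENNReal.tendsto_ofReal h0)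
      (Or.inr ENNReal.ofReal_ne_top)
  refine le_antisymm (ge_of_tendsto hlim ?_) bot_le
  filter_upwards [self_mem_nhdsWithin] with ε hε
  have hε' : 0 < ε := hε
  refine (measure_mono ?_).trans (h _ _)
  simp [hε']

theorem cdf_sub_le_of_measure_Ioo_le {μ : Measure ℝ} [IsProbabilityMeasure μ] (hC : 0 ≤ C)
    (h : ∀ a b, μ (Set.Ioo a b) ≤ ENNReal.ofReal C * ENNReal.ofReal (b - a)) {a b : ℝ}
    (hab : a ≤ b) : ProbabilityTheory.cdf μ b - ProbabilityTheory.cdf μ a ≤ C * (b - a) := by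
  have := nullSingletonClass_of_measure_Ioo_le h
  rw [ProbabilityTheory.cdf_eq_real, ProbabilityTheory.cdf_eq_real,
    ← measureReal_sdiff (Set.Iic_subset_Iic.2 hab) measurableSet_Iic, Set.Iic_sdiff_Iic,
    measureReal_def, ← measure_congr (Ioo_ae_eq_Ioc (μ := μ))]
  refine ENNReal.toReal_le_of_le_ofReal (mul_nonneg hC (sub_nonneg.2 hab)) ?_
  rw [ENNReal.ofReal_mul hC]
  exact h a b

theorem continuous_cdf_of_measure_Ioo_le {μ : Measure ℝ} [IsProbabilityMeasure μ] (hC : 0 ≤ C)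
    (h : ∀ a b, μ (Set.Ioo a b) ≤ ENNReal.ofReal C * ENNReal.ofReal (b - a)) :
    Continuous (ProbabilityTheory.cdf μ) := by
  refine (LipschitzWith.of_le_add_mul ⟨C, hC⟩ fun x y => ?_).continuous
  rcases le_total x y with hxy | hxy
  · exact (ProbabilityTheory.monotone_cdf μ hxy).trans
      (le_add_of_nonneg_right (mul_nonneg hC dist_nonneg))
  · have := cdf_sub_le_of_measure_Ioo_le hC h hxy
    rw [Real.dist_eq, abs_of_nonneg (sub_nonneg.2 hxy)]
    change _ ≤ _ + C * (x - y)
    linarith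

theorem measure_eq_zero_of_tendsto {Ω : Type*} [MeasurableSpace Ω] [TopologicalSpace Ω]
    [OpensMeasurableSpace Ω] [HasOuterApproxClosed Ω] {Q : ι → ProbabilityMeasure Ω}
    {ρ : ProbabilityMeasure Ω} (h : Tendsto Q L (𝓝 ρ)) {G : Set Ω} (hG : IsOpen G)
    (h0 : ∀ᶠ i in L, (Q i : Measure Ω) G = 0) : (ρ : Measure Ω) G = 0 := by
  refine le_antisymm ?_ bot_le
  refine (ProbabilityMeasure.le_liminf_measure_open_of_tendsto h hG).trans_eq ?_
  rw [liminf_congr h0, liminf_const]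

end Limits

/-- A probability measure on `[0, lam] × [0, 1]` whose marginals have densities at most `1 / lam`
is a `lam`-permuton. -/
theorem isLambdaPermuton_of_measure_Ioo_le {lam : ℝ} (hlam : lam ∈ Set.Ioc (0 : ℝ) 1)
    {μ : Measure (ℝ × ℝ)} [IsProbabilityMeasure μ]
    (hK : μ (Set.Icc 0 lam ×ˢ Set.Icc 0 1)ᶜ = 0)
    (h₁ : ∀ a b, μ.fst (Set.Ioo a b) ≤ ENNReal.ofReal lam⁻¹ * ENNReal.ofReal (b - a))
    (h₂ : ∀ a b, μ.snd (Set.Ioo a b) ≤ ENNReal.ofReal lam⁻¹ * ENNReal.ofReal (b - a)) :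
    IsLambdaPermuton lam μ := by
  have hC : 0 ≤ lam⁻¹ := inv_nonneg.2 hlam.1.le
  have hfst : μ.fst (Set.Icc 0 lam)ᶜ = 0 := by
    rw [Measure.fst_apply measurableSet_Icc.compl]
    exact measure_mono_null (Set.compl_subset_compl.2 fun p hp => hp.1) hK
  have := nullSingletonClass_of_measure_Ioo_le h₁
  have h0 : marginalX μ 0 = 0 := by
    rw [marginalX, ProbabilityTheory.cdf_eq_real, measureReal_def]
    have : μ.fst (Set.Iic 0) = 0 := by
      rw [← measure_congr (Iio_ae_eq_Iic (μ := μ.fst))]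
      exact measure_mono_null (t := (Set.Icc 0 lam)ᶜ) (fun x hx hx' => not_lt.2 hx'.1 hx) hfst
    rw [this, ENNReal.toReal_zero]
  have h1 : marginalX μ lam = 1 := by
    rw [marginalX, ProbabilityTheory.cdf_eq_real, ← compl_compl (Set.Iic lam),
      probReal_compl_eq_one_sub measurableSet_Iic.compl, measureReal_def,
      measure_mono_null (Set.compl_subset_compl.2 Set.Icc_subset_Iic_self) hfst, ENNReal.toReal_zero, sub_zero]
  refine ⟨hlam, inferInstance, hK, fun x hx => ?_, continuous_cdf_of_measure_Ioo_le hC h₂,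
    fun a b _ hab _ => ?_⟩
  -- The slope bound on `[0, x]` gives `F x ≤ x / lam`. On `[x, lam]` it gives the reverse, since a
  -- total increase of `1` over length `lam` leaves no slack.
  · have h2 := cdf_sub_le_of_measure_Ioo_le hC h₁ hx.1
    have h3 := cdf_sub_le_of_measure_Ioo_le hC h₁ hx.2
    unfold marginalX at h0 h1 ⊢
    rw [h0] at h2
    rw [h1, mul_sub, inv_mul_cancel₀ hlam.1.ne'] at h3
    rw [div_eq_inv_mul]
    linarith
  · rw [div_eq_inv_mul]
    exact cdf_sub_le_of_measure_Ioo_le hC h₂ hab.le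

/-! ### Compactness and identification of the limit -/

theorem tendsto_atTop_of_tendsto_div {m : ℕ → ℕ} {lam : ℝ} (hlam : 0 < lam)
    (hm : Tendsto (fun n : ℕ => (m n : ℝ) / (n : ℝ)) atTop (𝓝 lam)) :
    Tendsto m atTop atTop := by
  rw [← tendsto_natCast_atTop_iff (R := ℝ)]
  refine (hm.pos_mul_atTop hlam tendsto_natCast_atTop_atTop).congr' ?_
  filter_upwards [eventually_gt_atTop 0] with n hn
  have : (n : ℝ) ≠ 0 := by exact_mod_cast hn.ne'
  field_simp

/-- The measures of ordered selections of positive length have weak limits along every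
ultrafilter. -/
theorem exists_tendsto_permuton {m : ℕ → ℕ} (hpos : ∀ n, 1 ≤ n → 1 ≤ m n)
    (ν : ∀ n, OrderedSelection n (m n)) (U : Ultrafilter ℕ) :
    ∃ (P : ℕ → ProbabilityMeasure (ℝ × ℝ)) (μ : ProbabilityMeasure (ℝ × ℝ)),
      (∀ n, 1 ≤ n → (P n : Measure (ℝ × ℝ)) = (ν n).permuton) ∧ Tendsto P U (𝓝 μ) := by
  classical
  -- At index `0` the selection is empty and its measure is zero; a point mass inside the unit
  -- square replaces it, so that tightness holds for every index.
  let P : ℕ → ProbabilityMeasure (ℝ × ℝ) := fun n =>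
    if h : 1 ≤ n then ⟨(ν n).permuton, (ν n).isProbabilityMeasure_permuton (hpos n h)⟩
    else ⟨Measure.dirac 0, inferInstance⟩
  let K : Set (ℝ × ℝ) := Set.Icc 0 1 ×ˢ Set.Icc 0 1
  have hP : ∀ n, 1 ≤ n → (P n : Measure (ℝ × ℝ)) = (ν n).permuton := fun n hn => by
    simp [P, hn]
  have hPK : ∀ n, (P n : Measure (ℝ × ℝ)) Kᶜ = 0 := by
    intro n
    by_cases hn : 1 ≤ n
    · rw [hP n hn]
      refine measure_mono_null (Set.compl_subset_compl.2 (Set.prod_mono_left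
        (Set.Icc_subset_Icc_right (div_le_one_of_le₀ ?_ n.cast_nonneg))))
        (ν n).permuton_compl_rectangle
      have := Fintype.card_le_of_embedding (ν n)
      simp only [Fintype.card_fin] at this
      exact_mod_cast this
    · have h0 : (P n : Measure (ℝ × ℝ)) = Measure.dirac 0 := by simp [P, hn]
      have hmem : (0 : ℝ × ℝ) ∈ K :=
        ⟨Set.left_mem_Icc.2 zero_le_one, Set.left_mem_Icc.2 zero_le_one⟩
      rw [h0, Measure.dirac_apply, Set.indicator_of_notMem (Set.notMem_compl_iff.2 hmem)]
  -- Prokhorov compactness with a single compact set and no mass allowed outside it.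
  have hcomp := isCompact_setOfPred_probabilityMeasure_mass_eq_compl_isCompact_le
    (E := ℝ × ℝ) (u := fun _ => 0) (K := fun _ => K) tendsto_const_nhds
    (fun _ => isCompact_Icc.prod isCompact_Icc) (Or.inr monotone_const)
  obtain ⟨μ, -, hμ⟩ := hcomp.ultrafilter_le_nhds (U.map P) (by
    rw [Ultrafilter.coe_map, le_principal_iff]
    refine Filter.mem_map.2 (univ_mem' fun n => ?_)
    intro _
    rw [nonpos_iff_eq_zero, ProbabilityMeasure.null_iff_toMeasure_null]
    exact hPK n)
  exact ⟨P, μ, hP, hμ⟩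

/-- The sequence is indexed by `n ≥ 1`; the index `0` carries only the empty selection and does
not affect any limit. -/
theorem mainTheorem1 (m : ℕ → ℕ) (hpos : ∀ n, 1 ≤ n → 1 ≤ m n) (lam : ℝ)
    (hlam : lam ∈ Set.Ioc (0 : ℝ) 1)
    (hm : Tendsto (fun n : ℕ => (m n : ℝ) / (n : ℝ)) atTop (𝓝 lam))
    (ν : ∀ n : ℕ, OrderedSelection n (m n)) (hν : IsConvergentSelection ν) :
    ∃ μ : Measure (ℝ × ℝ), IsGeneralizedPermuton μ ∧
      TendstoPermDensities (fun n => (ν n).permuton) μ := by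
  let U : Ultrafilter ℕ := Ultrafilter.of atTop
  have hU : (U : Filter ℕ) ≤ atTop := Ultrafilter.of_le atTop
  obtain ⟨P, μ, hP, hPμ⟩ := exists_tendsto_permuton hpos ν U
  have hPU : ∀ᶠ n in (U : Filter ℕ), (P n : Measure (ℝ × ℝ)) = (ν n).permuton ∧ 0 < m n :=
    hU ((eventually_ge_atTop 1).mono fun n hn => ⟨hP n hn, hpos n hn⟩)
  have hfst := ((ProbabilityMeasure.continuous_map continuous_fst).tendsto μ).comp hPμ
  have hsnd := ((ProbabilityMeasure.continuous_map continuous_snd).tendsto μ).comp hPμ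
  have hc : Tendsto (fun n : ℕ => (n : ℝ) / m n) U (𝓝 lam⁻¹) :=
    ((hm.inv₀ hlam.1.ne').congr fun n => inv_div _ _).mono_left hU
  have h₁ : ∀ a b, (μ : Measure (ℝ × ℝ)).fst (Set.Ioo a b) ≤
      ENNReal.ofReal lam⁻¹ * ENNReal.ofReal (b - a) :=
    measure_Ioo_le_of_tendsto hfst hc (hPU.mono fun n hn A hA => by
      have := (ν n).fst_permuton_le hn.2 hA
      rwa [← hn.1] at this)
  have h₂ : ∀ a b, (μ : Measure (ℝ × ℝ)).snd (Set.Ioo a b) ≤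
      ENNReal.ofReal lam⁻¹ * ENNReal.ofReal (b - a) :=
    measure_Ioo_le_of_tendsto hsnd hc (hPU.mono fun n hn A hA => by
      have := (ν n).snd_permuton_le hn.2 hA
      rwa [← hn.1] at this)
  have hatom₁ := nullSingletonClass_of_measure_Ioo_le h₁
  have hatom₂ := nullSingletonClass_of_measure_Ioo_le h₂
  have hK : (μ : Measure (ℝ × ℝ)) (Set.Icc 0 lam ×ˢ Set.Icc 0 1)ᶜ = 0 := by
    -- The supporting rectangles have varying width `m n / n`, possibly above `lam`; slightly wider
    -- closed rectangles eventually contain them, and the slack is then removed by a countable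
    -- intersection.
    have hε : ∀ j : ℕ, (μ : Measure (ℝ × ℝ))
        (Set.Icc 0 (lam + 1 / ((j : ℝ) + 1)) ×ˢ Set.Icc 0 1)ᶜ = 0 := by
      intro j
      refine measure_eq_zero_of_tendsto hPμ (isClosed_Icc.prod isClosed_Icc).isOpen_compl ?_
      have hlt : lam < lam + 1 / ((j : ℝ) + 1) := lt_add_of_pos_right _ (by positivity)
      filter_upwards [hPU, (hm.mono_left hU).eventually_le_const hlt] with n hn hle
      rw [hn.1]
      exact measure_mono_null (Set.compl_subset_compl.2 (Set.prod_mono_left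
        (Set.Icc_subset_Icc_right hle))) (ν n).permuton_compl_rectangle
    refine measure_mono_null (fun p hp => ?_) (measure_iUnion_null hε)
    by_contra hcon
    simp only [Set.mem_iUnion, Set.mem_compl_iff, not_exists, not_not] at hcon
    refine hp ⟨⟨(hcon 0).1.1, ?_⟩, (hcon 0).2⟩
    have hlim : Tendsto (fun j : ℕ => lam + 1 / ((j : ℝ) + 1)) atTop (𝓝 lam) := by
      simpa using tendsto_one_div_add_atTop_nhds_zero_nat.const_add lam
    exact ge_of_tendsto' hlim fun j => (hcon j).1.2
  -- A limit known to exist along `atTop` is also the limit along the finer `U`, where it must equal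
  -- `F μ`.
  have hmem : ∀ {F : Measure (ℝ × ℝ) → ℝ} {t : ℝ},
      Tendsto (fun n => F (ν n).permuton) atTop (𝓝 t) →
      Tendsto (fun n => F (P n)) U (𝓝 (F μ)) →
      Tendsto (fun n => F (ν n).permuton) atTop (𝓝 (F μ)) := by
    intro F t ht hF
    have heq := hF.congr' (hPU.mono fun n hn => by rw [hn.1])
    rwa [← tendsto_nhds_unique (ht.mono_left hU) heq]
  refine ⟨μ, ⟨lam, isLambdaPermuton_of_measure_Ioo_le hlam hK h₁ h₂⟩, fun k τ => ?_,
    fun x _ => ?_, fun y _ => ?_⟩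
  · obtain ⟨t, ht⟩ := hν.permDensity k τ
    have ht' := (tendsto_permDensity_permuton_sub ν
      (tendsto_atTop_of_tendsto_div hlam.1 hm) τ).add ht
    simp only [sub_add_cancel] at ht'
    exact hmem ht' (tendsto_permDensity_of_tendsto τ hatom₁ hatom₂ hPμ)
  · obtain ⟨t, ht⟩ := hν.marginalX x
    exact hmem (F := fun ρ => marginalX ρ x) ht (tendsto_cdf_of_tendsto hfst hatom₁ x)
  · obtain ⟨t, ht⟩ := hν.marginalY y
    exact hmem (F := fun ρ => marginalY ρ y) ht (tendsto_cdf_of_tendsto hsnd hatom₂ y)
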